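/- A $\mathcal{C}^{\infty}$-ring is a set $A$ together with an operation $\Phi(f)\colon A^n\to A$ for every $n\in\mathbb{N}$ and every smooth function $f\colon\mathbb{R}^n\to\mathbb{R}$, such that $\Phi(\pi_k)(x_1,\dots,x_n)=x_k$ for every projection $\pi_k\colon\mathbb{R}^n\to\mathbb{R}$, and $\Phi(h\circ(g_1,\dots,g_n))(\vec{x})=\Phi(h)(\Phi(g_1)(\vec{x}),\dots,\Phi(g_n)(\vec{x}))$ for all smooth $h\colon\mathbb{R}^n\to\mathbb{R}$ and $g_1,\dots,g_n\colon\mathbb{R}^m\to\mathbb{R}$. A $\mathcal{C}^{\infty}$-homomorphism is a map commuting with all these operations; $\mathcal{C}^{\infty}\mathbf{Ring}$ denotes the resulting category. The interpretations of $+$, $\cdot$, $-$, $0$, $1$ make every $\mathcal{C}^{\infty}$-ring $A$ a commutative unital ring; $A$ is called a $\mathcal{C}^{\infty}$-field if this ring is a field, and von Neumann regular if for every $a\in A$ there is an $x\in A$ with $a=a^2x$. Let $\mathcal{C}^{\infty}\mathbf{vNRing}$ be the full subcategory of $\mathcal{C}^{\infty}\mathbf{Ring}$ on the von Neumann regular $\mathcal{C}^{\infty}$-rings.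 Say that a full subcategory $\mathcal{P}$ of $\mathcal{C}^{\infty}\mathbf{Ring}$ is closed under limits if every limit, formed in $\mathcal{C}^{\infty}\mathbf{Ring}$, of a small diagram of objects of $\mathcal{P}$ is again an object of $\mathcal{P}$. Then $\mathcal{C}^{\infty}\mathbf{vNRing}$ is the smallest full subcategory of $\mathcal{C}^{\infty}\mathbf{Ring}$ that contains all $\mathcal{C}^{\infty}$-fields and is closed under limits: it contains all $\mathcal{C}^{\infty}$-fields and is closed under limits, and every full subcategory of $\mathcal{C}^{\infty}\mathbf{Ring}$ with these two properties contains every von Neumann regular $\mathcal{C}^{\infty}$-ring. -/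

import Mathlib

open CategoryTheory
open scoped ContDiff

universe u

/-- Smooth functions `ℝⁿ → ℝ`, the `n`-ary function symbols of the language of `C^∞`-rings. -/
def SmoothFun (n : ℕ) : Type :=
  {f : (Fin n → ℝ) → ℝ // ContDiff ℝ ∞ f}

namespace SmoothFun

/-- The projection `π_k : ℝⁿ → ℝ`. -/
def proj {n : ℕ} (k : Fin n) : SmoothFun n :=
  ⟨fun x => x k, by fun_prop⟩

/-- The composite `h ∘ (g₁, …, gₙ) : ℝᵐ → ℝ`. -/
def comp {n m : ℕ} (h : SmoothFun n) (g : Fin n → SmoothFun m) : SmoothFun m :=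
  ⟨fun x => h.1 (fun i => (g i).1 x), h.2.comp (contDiff_pi.2 fun i => (g i).2)⟩

/-- Addition `ℝ² → ℝ`. -/
def add : SmoothFun 2 := ⟨fun x => x 0 + x 1, by fun_prop⟩

/-- Multiplication `ℝ² → ℝ`. -/
def mul : SmoothFun 2 := ⟨fun x => x 0 * x 1, by fun_prop⟩

/-- Negation `ℝ → ℝ`. -/
def neg : SmoothFun 1 := ⟨fun x => - x 0, by fun_prop⟩

/-- The constant `c`, as a smooth function `ℝ⁰ → ℝ`. -/
def const (c : ℝ) : SmoothFun 0 := ⟨fun _ => c, by fun_prop⟩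

end SmoothFun

/-- A `C^∞`-ring structure on a type `A`: an interpretation of every smooth function `ℝⁿ → ℝ`
(for every `n`, including `n = 0`) as an operation `Aⁿ → A`, compatible with projections and with
composition. (`A` is automatically non-empty, because of the constants.) -/
class CInftyRing (A : Type u) where
  /-- The interpretation of a smooth function. -/
  op : ∀ {n : ℕ}, SmoothFun n → (Fin n → A) → A
  op_proj : ∀ {n : ℕ} (k : Fin n) (x : Fin n → A), op (SmoothFun.proj k) x = x k
  op_comp : ∀ {n m : ℕ} (h : SmoothFun n) (g : Fin n → SmoothFun m) (x : Fin m → A),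
    op (h.comp g) x = op h (fun i => op (g i) x)

namespace CInftyRing

variable {A : Type u} [CInftyRing A]

theorem op_binary {m : ℕ} (h : SmoothFun 2) (f g : SmoothFun m) (x : Fin m → A) :
    op h ![op f x, op g x] = op (h.comp ![f, g]) x := by
  rw [op_comp]
  congr 1
  funext i
  fin_cases i <;> rfl

theorem op_unary {m : ℕ} (h : SmoothFun 1) (f : SmoothFun m) (x : Fin m → A) :
    op h ![op f x] = op (h.comp ![f]) x := by
  rw [op_comp]
  congr 1
  funext i
  fin_cases i
  rfl

theorem op_nullary {m : ℕ} (h : SmoothFun 0) (x : Fin m → A) :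
    op h ![] = op (h.comp ![]) x := by
  rw [op_comp]
  congr 1
  funext i
  exact i.elim0

/-- The underlying commutative unital ring of a `C^∞`-ring: its operations are the interpretations
of the addition, multiplication and negation of real numbers and of the constants `0` and `1`. -/
@[reducible]
def toCommRing (A : Type u) [CInftyRing A] : CommRing A :=
  letI : Add A := ⟨fun a b => op SmoothFun.add ![a, b]⟩
  letI : Mul A := ⟨fun a b => op SmoothFun.mul ![a, b]⟩
  letI : Neg A := ⟨fun a => op SmoothFun.neg ![a]⟩
  letI : Zero A := ⟨op (SmoothFun.const 0) ![]⟩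
  letI : One A := ⟨op (SmoothFun.const 1) ![]⟩
  CommRing.ofMinimalAxioms
    (fun a b c => by
      change op SmoothFun.add ![op SmoothFun.add ![a, b], c]
        = op SmoothFun.add ![a, op SmoothFun.add ![b, c]]
      obtain ⟨x, rfl, rfl, rfl⟩ : ∃ x : Fin 3 → A,
        op (SmoothFun.proj 0) x = a ∧ op (SmoothFun.proj 1) x = b ∧ op (SmoothFun.proj 2) x = c :=
        ⟨![a, b, c], by simp [op_proj]⟩
      simp only [op_binary]
      congr 1
      exact Subtype.ext (funext fun y => add_assoc (y 0) (y 1) (y 2)))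
    (fun a => by
      change op SmoothFun.add ![op (SmoothFun.const 0) ![], a] = a
      obtain ⟨x, rfl⟩ : ∃ x : Fin 1 → A, op (SmoothFun.proj 0) x = a := ⟨![a], by simp [op_proj]⟩
      rw [op_nullary _ x, op_binary]
      congr 1
      exact Subtype.ext (funext fun y => zero_add (y 0)))
    (fun a => by
      change op SmoothFun.add ![op SmoothFun.neg ![a], a] = op (SmoothFun.const 0) ![]
      obtain ⟨x, rfl⟩ : ∃ x : Fin 1 → A, op (SmoothFun.proj 0) x = a := ⟨![a], by simp [op_proj]⟩
      rw [op_nullary _ x, op_unary, op_binary]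
      congr 1
      exact Subtype.ext (funext fun y => neg_add_cancel (y 0)))
    (fun a b c => by
      change op SmoothFun.mul ![op SmoothFun.mul ![a, b], c]
        = op SmoothFun.mul ![a, op SmoothFun.mul ![b, c]]
      obtain ⟨x, rfl, rfl, rfl⟩ : ∃ x : Fin 3 → A,
        op (SmoothFun.proj 0) x = a ∧ op (SmoothFun.proj 1) x = b ∧ op (SmoothFun.proj 2) x = c :=
        ⟨![a, b, c], by simp [op_proj]⟩
      simp only [op_binary]
      congr 1
      exact Subtype.ext (funext fun y => mul_assoc (y 0) (y 1) (y 2)))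
    (fun a b => by
      change op SmoothFun.mul ![a, b] = op SmoothFun.mul ![b, a]
      obtain ⟨x, rfl, rfl⟩ : ∃ x : Fin 2 → A,
        op (SmoothFun.proj 0) x = a ∧ op (SmoothFun.proj 1) x = b := ⟨![a, b], by simp [op_proj]⟩
      simp only [op_binary]
      congr 1
      exact Subtype.ext (funext fun y => mul_comm (y 0) (y 1)))
    (fun a => by
      change op SmoothFun.mul ![op (SmoothFun.const 1) ![], a] = a
      obtain ⟨x, rfl⟩ : ∃ x : Fin 1 → A, op (SmoothFun.proj 0) x = a := ⟨![a], by simp [op_proj]⟩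
      rw [op_nullary _ x, op_binary]
      congr 1
      exact Subtype.ext (funext fun y => one_mul (y 0)))
    (fun a b c => by
      change op SmoothFun.mul ![a, op SmoothFun.add ![b, c]]
        = op SmoothFun.add ![op SmoothFun.mul ![a, b], op SmoothFun.mul ![a, c]]
      obtain ⟨x, rfl, rfl, rfl⟩ : ∃ x : Fin 3 → A,
        op (SmoothFun.proj 0) x = a ∧ op (SmoothFun.proj 1) x = b ∧ op (SmoothFun.proj 2) x = c :=
        ⟨![a, b, c], by simp [op_proj]⟩
      simp only [op_binary]
      congr 1
      exact Subtype.ext (funext fun y => mul_add (y 0) (y 1) (y 2)))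

end CInftyRing

/-- The objects of the category of `C^∞`-rings (on sets of a fixed universe). -/
structure CInftyRingCat : Type (u + 1) where
  carrier : Type u
  [str : CInftyRing carrier]

namespace CInftyRingCat

instance : CoeSort CInftyRingCat.{u} (Type u) := ⟨carrier⟩

instance (A : CInftyRingCat.{u}) : CInftyRing A := A.str

instance (A : CInftyRingCat.{u}) : CommRing A := CInftyRing.toCommRing A.carrier

/-- A `C^∞`-homomorphism: a map commuting with the interpretations of all smooth functions. -/
@[ext]
structure Hom (A B : CInftyRingCat.{u}) : Type u where
  toFun : A → B
  map_op : ∀ {n : ℕ} (f : SmoothFun n) (x : Fin n → A),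
    toFun (CInftyRing.op f x) = CInftyRing.op f (fun i => toFun (x i))

/-- The category of `C^∞`-rings and `C^∞`-homomorphisms. -/
instance : Category.{u} CInftyRingCat.{u} where
  Hom A B := Hom A B
  id A := ⟨fun a => a, fun _ _ => rfl⟩
  comp φ ψ := ⟨fun a => ψ.toFun (φ.toFun a), fun f x => by rw [φ.map_op, ψ.map_op]⟩

/-- `C^∞`-fields: the `C^∞`-rings whose underlying commutative ring is a field. -/
def IsCInftyField : ObjectProperty CInftyRingCat.{u} :=
  fun A => IsField A

/-- Von Neumann regular `C^∞`-rings: every `a` is of the form `a² x`. As a property of objects of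
the category of `C^∞`-rings, this is the full subcategory of von Neumann regular `C^∞`-rings. -/
def IsVonNeumannRegular : ObjectProperty CInftyRingCat.{u} :=
  fun A => ∀ a : A, ∃ x : A, a = a ^ 2 * x

/-- The full subcategory defined by `P` is closed under (small) limits in the category of
`C^∞`-rings: every object that is the apex of a limit cone, in the category of `C^∞`-rings, over
a small diagram of objects of `P` belongs to `P`. -/
def IsClosedUnderLimits (P : ObjectProperty CInftyRingCat.{u}) : Prop :=
  ∀ (J : Type u) [SmallCategory J], P.IsClosedUnderLimitsOfShape J

end CInftyRingCat

/-! Von Neumann regularity amounts to having quasi-inverses, which are unique, hence preserved by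
homomorphisms and assembled componentwise in a limit; this gives closure under limits. For
minimality, a regular `A` is exhibited as an equalizer of two maps between products of `C^∞`-fields.
Idempotents localize smooth operations (`mul_op_eq_mul_op_mul`), so in a regular ring every ideal is
a `C^∞`-congruence (`op_sub_op_mem`), and each `A ⧸ m` with `m` maximal is a `C^∞`-field. Let `B` be
the product of these fields. For each maximal ideal `M` of `B` over `m`, an element of `B` has two
values in `B ⧸ M`: its class, and the image of its `m`-coordinate under `A ⧸ m → B ⧸ M`. Elements
with equal values at every `M` agree with elements of `A` locally on the spectrum of `A`
(`exists_notMem_map_mul_eq_zero`), hence come from `A`. -/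

open CategoryTheory.Limits
open scoped Topology

/-! ### Cutoff functions and smooth division -/

namespace SmoothFun

/-- The pointwise product of two smooth functions. -/
def pmul {n : ℕ} (f g : SmoothFun n) : SmoothFun n :=
  ⟨fun x => f.1 x * g.1 x, f.2.mul g.2⟩

/-- The pointwise difference of two smooth functions. -/
def psub {n : ℕ} (f g : SmoothFun n) : SmoothFun n :=
  ⟨fun x => f.1 x - g.1 x, f.2.sub g.2⟩

/-- The constant function `1` of `n` variables. -/
def pone (n : ℕ) : SmoothFun n :=
  ⟨fun _ => 1, contDiff_const⟩

/-- A smooth function `ℝ → ℝ` which vanishes near `0` and equals `1` near `1`. -/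
noncomputable def step : SmoothFun 1 :=
  -- The rescaling gives the value `0` for arguments at most `1/3` and `1` for those at least `2/3`.
  ⟨fun x => Real.smoothTransition (3 * x 0 - 1),
    Real.smoothTransition.contDiff.comp (by fun_prop)⟩

theorem step_eventually_eq_zero {n : ℕ} {i : Fin n} {y : Fin n → ℝ} (hy : y i = 0) :
    ∀ᶠ z in 𝓝 y, Real.smoothTransition (3 * z i - 1) = 0 := by
  have h : ∀ᶠ z in 𝓝 y, z i < 1 / 3 :=
    (continuous_apply i).continuousAt.eventually_lt_const (by simp only [hy]; norm_num)
  filter_upwards [h] with z hz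
  exact Real.smoothTransition.zero_of_nonpos (by linarith)

theorem step_eventually_eq_one {n : ℕ} {i : Fin n} {y : Fin n → ℝ} (hy : y i = 1) :
    ∀ᶠ z in 𝓝 y, Real.smoothTransition (3 * z i - 1) = 1 := by
  have h : ∀ᶠ z in 𝓝 y, 2 / 3 < z i :=
    (continuous_apply i).continuousAt.eventually_const_lt (by simp only [hy]; norm_num)
  filter_upwards [h] with z hz
  exact Real.smoothTransition.one_of_one_le (by linarith)

/-- A smooth function which vanishes near the zero set of `p` is divisible by `p`. -/
theorem exists_eq_pmul {n : ℕ} (p h : SmoothFun n)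
    (H : ∀ y, p.1 y = 0 → ∀ᶠ z in 𝓝 y, h.1 z = 0) : ∃ q, h = p.pmul q := by
  refine ⟨⟨fun y => h.1 y / p.1 y, contDiff_iff_contDiffAt.2 fun y => ?_⟩, ?_⟩
  · by_cases hy : p.1 y = 0
    · refine (contDiffAt_const (c := (0 : ℝ))).congr_of_eventuallyEq ?_
      filter_upwards [H y hy] with z hz
      rw [hz, zero_div]
    · exact h.2.contDiffAt.div p.2.contDiffAt hy
  · refine Subtype.ext (funext fun y => ?_)
    change h.1 y = p.1 y * (h.1 y / p.1 y)
    by_cases hy : p.1 y = 0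
    · rw [hy, zero_mul, (H y hy).self_of_nhds]
    · rw [mul_div_cancel₀ _ hy]

end SmoothFun

namespace CInftyRingCat

open CInftyRing

/-! ### Smooth operations and idempotents -/

section Operations

variable {A : CInftyRingCat.{u}} {n : ℕ}

theorem op_pmul (f g : SmoothFun n) (v : Fin n → A) :
    op (f.pmul g) v = op f v * op g v :=
  (op_binary SmoothFun.mul f g v).symm

theorem op_psub (f g : SmoothFun n) (v : Fin n → A) :
    op (f.psub g) v = op f v - op g v := by
  rw [eq_sub_iff_add_eq]
  refine (op_binary SmoothFun.add (f.psub g) g v).trans ?_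
  congr 1
  exact Subtype.ext (funext fun y => sub_add_cancel (f.1 y) (g.1 y))

theorem op_pone (v : Fin n → A) : op (SmoothFun.pone n) v = 1 :=
  (op_nullary (SmoothFun.const 1) v).symm

/-- Dividing `step` by `t` and `step - 1` by `t - 1` shows that the value at `e` is killed by `1 -
e`, and its difference from `1` by `e`. -/
theorem op_step_of_isIdempotentElem {e : A} (he : IsIdempotentElem e) :
    op SmoothFun.step ![e] = e := by
  have h0 : op (SmoothFun.proj 0) ![e] = e := op_proj _ _
  obtain ⟨q, hq⟩ := SmoothFun.exists_eq_pmul (SmoothFun.proj 0) SmoothFun.step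
    fun _ hy => SmoothFun.step_eventually_eq_zero (i := 0) hy
  obtain ⟨r, hr⟩ := SmoothFun.exists_eq_pmul ((SmoothFun.proj 0).psub (SmoothFun.pone 1))
    (SmoothFun.step.psub (SmoothFun.pone 1)) fun y hy => by
      filter_upwards [SmoothFun.step_eventually_eq_one (i := 0) (sub_eq_zero.1 hy)] with z hz
      exact sub_eq_zero.2 hz
  replace hq := congrArg (fun f => op f ![e]) hq
  replace hr := congrArg (fun f => op f ![e]) hr
  simp only [op_pmul, op_psub, op_pone, h0] at hq hr
  have he' : e * e = e := he
  linear_combination (1 - e) * hq + e * hr + (op r ![e] - op q ![e]) * he'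

/-- With `χ = step(t)`, the function `χ(t) (f(x) - f(χ(t) x))` vanishes near `t = 0` and near `t =
1`, so `t² - t` divides it; evaluate at `t = e`. Using `t` in place of `χ` would give vanishing only
on these two hyperplanes, not near them. -/
theorem mul_op_eq_mul_op_mul {e : A} (he : IsIdempotentElem e) (f : SmoothFun n)
    (x : Fin n → A) : e * op f x = e * op f (fun i => e * x i) := by
  let v : Fin (n + 1) → A := Fin.cons e x
  let t : SmoothFun (n + 1) := SmoothFun.proj 0
  let χ : SmoothFun (n + 1) := SmoothFun.step.comp ![t]
  let f₁ : SmoothFun (n + 1) := f.comp fun i => SmoothFun.proj i.succ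
  let f₂ : SmoothFun (n + 1) := f.comp fun i => χ.pmul (SmoothFun.proj i.succ)
  have ht : op t v = e := op_proj _ _
  have hx (i : Fin n) : op (SmoothFun.proj i.succ) v = x i := op_proj _ _
  have hχ : op χ v = e := by
    rw [← op_unary, ht, op_step_of_isIdempotentElem he]
  have h₁ : op f₁ v = op f x := by
    simp only [f₁, CInftyRing.op_comp, hx]
  have h₂ : op f₂ v = op f (fun i => e * x i) := by
    simp only [f₂, CInftyRing.op_comp, op_pmul, hx, hχ]
  obtain ⟨q, hq⟩ := SmoothFun.exists_eq_pmul ((t.pmul t).psub t) (χ.pmul (f₁.psub f₂))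
    fun y hy => by
      have hy' : y 0 * y 0 - y 0 = 0 := hy
      have : y 0 = 0 ∨ y 0 = 1 := by
        rcases mul_eq_zero.1 (show y 0 * (y 0 - 1) = 0 by linarith) with h | h
        · exact .inl h
        · exact .inr (by linarith)
      rcases this with h | h
      · filter_upwards [SmoothFun.step_eventually_eq_zero h] with z hz
        exact mul_eq_zero_of_left hz _
      · filter_upwards [SmoothFun.step_eventually_eq_one h] with z hz
        refine mul_eq_zero_of_right _ (sub_eq_zero.2 (congrArg f.1 (funext fun i => ?_)))
        change z i.succ = Real.smoothTransition (3 * z 0 - 1) * z i.succ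
        rw [hz, one_mul]
  replace hq := congrArg (fun f => op f v) hq
  simp only [op_pmul, op_psub, ht, hχ, h₁, h₂] at hq
  have he' : e * e = e := he
  linear_combination hq + op q v * he'

end Operations

/-! ### Quotients of regular rings by ideals -/

section Regular

variable {A : CInftyRingCat.{u}}

/-- If `d = d² z`, then `1 - d z` is an idempotent that kills `d` and is congruent to `1` modulo
`I`; multiply these over all `i`. -/
theorem exists_idempotent_mul_eq_zero (hA : IsVonNeumannRegular A) (I : Ideal A) {n : ℕ}
    (d : Fin n → A) (hd : ∀ i, d i ∈ I) :
    ∃ e : A, IsIdempotentElem e ∧ 1 - e ∈ I ∧ ∀ i, e * d i = 0 := by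
  choose z hz using fun i => hA (d i)
  refine ⟨∏ i, (1 - d i * z i), ?_, ?_, fun i => ?_⟩
  · rw [IsIdempotentElem, ← Finset.prod_mul_distrib]
    exact Finset.prod_congr rfl fun i _ => by linear_combination (-z i) * hz i
  · rw [← Ideal.Quotient.eq, map_prod, map_one, eq_comm]
    refine Finset.prod_eq_one fun i _ => ?_
    rw [← map_one (Ideal.Quotient.mk I), Ideal.Quotient.eq]
    simpa using I.mul_mem_right (z i) (hd i)
  · obtain ⟨c, hc⟩ := Finset.dvd_prod_of_mem (fun i => 1 - d i * z i) (Finset.mem_univ i)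
    rw [hc]
    linear_combination c * hz i

/-- In a von Neumann regular `C^∞`-ring, congruence modulo an ideal is compatible with all smooth
operations. -/
theorem op_sub_op_mem (hA : IsVonNeumannRegular A) (I : Ideal A) {n : ℕ} (f : SmoothFun n)
    {x y : Fin n → A} (h : ∀ i, x i - y i ∈ I) : op f x - op f y ∈ I := by
  obtain ⟨e, he, heI, hxy⟩ := exists_idempotent_mul_eq_zero hA I _ h
  have hxy' : (fun i => e * x i) = fun i => e * y i :=
    funext fun i => sub_eq_zero.1 (by rw [← mul_sub, hxy])
  have key : e * op f x = e * op f y := by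
    rw [mul_op_eq_mul_op_mul he, hxy', ← mul_op_eq_mul_op_mul he]
  have : op f x - op f y = (op f x - op f y) * (1 - e) := by linear_combination key
  rw [this]
  exact I.mul_mem_left _ heI

/-- The quotient of a von Neumann regular `C^∞`-ring by an ideal. -/
noncomputable def quotient (A : CInftyRingCat.{u}) (hA : IsVonNeumannRegular A) (I : Ideal A) :
    CInftyRingCat.{u} where
  carrier := A ⧸ I
  str :=
    { op := fun f x => Ideal.Quotient.mk I (op f fun i => (x i).out)
      op_proj := fun k x => by
        rw [op_proj]
        exact Quotient.out_eq _
      op_comp := fun h g x => by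
        rw [CInftyRing.op_comp, Ideal.Quotient.eq]
        refine op_sub_op_mem hA I h fun i => ?_
        rw [← Ideal.Quotient.eq]
        exact (Quotient.out_eq _).symm }

/-- The quotient map of a von Neumann regular `C^∞`-ring modulo an ideal. -/
noncomputable def quotientMk (hA : IsVonNeumannRegular A) (I : Ideal A) : A ⟶ quotient A hA I where
  toFun a := Ideal.Quotient.mk I a
  map_op f x := by
    refine Ideal.Quotient.eq.2 (op_sub_op_mem hA I f fun i => ?_)
    rw [← Ideal.Quotient.eq]
    exact (Quotient.out_eq _).symm

/-- The ring homomorphism underlying a `C^∞`-homomorphism. -/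
def Hom.toRingHom {A B : CInftyRingCat.{u}} (φ : A ⟶ B) : A →+* B where
  toFun := Hom.toFun φ
  map_one' := (Hom.map_op φ _ _).trans (congrArg _ (Subsingleton.elim _ _))
  map_zero' := (Hom.map_op φ _ _).trans (congrArg _ (Subsingleton.elim _ _))
  map_mul' a b := (Hom.map_op φ _ _).trans <| congrArg _ <| funext fun i => by
    fin_cases i <;> rfl
  map_add' a b := (Hom.map_op φ _ _).trans <| congrArg _ <| funext fun i => by
    fin_cases i <;> rfl

theorem quotientMk_surjective (hA : IsVonNeumannRegular A) (I : Ideal A) :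
    Function.Surjective (Hom.toRingHom (quotientMk hA I)) :=
  Ideal.Quotient.mk_surjective

theorem quotientMk_eq_iff (hA : IsVonNeumannRegular A) (I : Ideal A) {a b : A} :
    Hom.toRingHom (quotientMk hA I) a = Hom.toRingHom (quotientMk hA I) b ↔ a - b ∈ I :=
  Ideal.Quotient.eq

theorem quotientMk_eq_zero_iff (hA : IsVonNeumannRegular A) (I : Ideal A) {a : A} :
    Hom.toRingHom (quotientMk hA I) a = 0 ↔ a ∈ I := by
  rw [← map_zero (Hom.toRingHom (quotientMk hA I)), quotientMk_eq_iff, sub_zero]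

theorem isCInftyField_quotient (hA : IsVonNeumannRegular A) (I : Ideal A) [hI : I.IsMaximal] :
    IsCInftyField (quotient A hA I) where
  exists_pair_ne := ⟨0, 1, fun h => hI.ne_top <| I.eq_top_iff_one.2 <|
    (quotientMk_eq_zero_iff hA I).1 (by rw [map_one, h])⟩
  mul_comm := mul_comm
  mul_inv_cancel := fun {q} hq => by
    obtain ⟨a, rfl⟩ := quotientMk_surjective hA I q
    obtain ⟨b, i, hi, hb⟩ := hI.exists_inv (mt (quotientMk_eq_zero_iff hA I).2 hq)
    refine ⟨Hom.toRingHom (quotientMk hA I) b, ?_⟩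
    rw [← map_mul, ← map_one (Hom.toRingHom (quotientMk hA I)), quotientMk_eq_iff]
    rw [show a * b - 1 = -i by linear_combination hb]
    exact I.neg_mem hi

/-- A `C^∞`-homomorphism which kills an ideal factors through the quotient. -/
noncomputable def quotientLift {B : CInftyRingCat.{u}} (hA : IsVonNeumannRegular A) (I : Ideal A)
    (φ : A ⟶ B) (hφ : ∀ a ∈ I, Hom.toRingHom φ a = 0) : quotient A hA I ⟶ B where
  toFun q := Hom.toFun φ (Quotient.out (s := Submodule.quotientRel I) q)
  map_op f x := by
    rw [← Hom.map_op φ]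
    change Hom.toRingHom φ _ = Hom.toRingHom φ _
    rw [← sub_eq_zero, ← map_sub]
    refine hφ _ (Ideal.Quotient.eq.1 ?_)
    exact Quotient.out_eq _

theorem quotientLift_quotientMk {B : CInftyRingCat.{u}} (hA : IsVonNeumannRegular A) (I : Ideal A)
    (φ : A ⟶ B) (hφ : ∀ a ∈ I, Hom.toRingHom φ a = 0) (a : A) :
    Hom.toRingHom (quotientLift hA I φ hφ) (Hom.toRingHom (quotientMk hA I) a) =
      Hom.toRingHom φ a := by
  change Hom.toRingHom φ _ = Hom.toRingHom φ _
  rw [← sub_eq_zero, ← map_sub]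
  refine hφ _ (Ideal.Quotient.eq.1 ?_)
  exact Quotient.out_eq _

end Regular

/-! ### Limits and closure of regularity -/

section Limits

variable {J : Type u} [SmallCategory J] (F : J ⥤ CInftyRingCat.{u})

/-- The `C^∞`-ring of compatible families of elements of a diagram of `C^∞`-rings. -/
def sectionsRing : CInftyRingCat.{u} where
  carrier := {s : ∀ j, F.obj j // ∀ ⦃i j : J⦄ (f : i ⟶ j), Hom.toFun (F.map f) (s i) = s j}
  str :=
    { op := fun f x => ⟨fun j => op f fun i => (x i).1 j, fun _ _ g => by
        rw [Hom.map_op]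
        exact congrArg _ (funext fun k => (x k).2 g)⟩
      op_proj := fun k x => Subtype.ext <| funext fun j => op_proj _ _
      op_comp := fun h g x => Subtype.ext <| funext fun j => CInftyRing.op_comp _ _ _ }

/-- The cone of evaluations on the `C^∞`-ring of compatible families. -/
def sectionsCone : Cone F where
  pt := sectionsRing F
  π :=
    { app := fun j => (⟨fun s => s.1 j, fun _ _ => rfl⟩ : Hom (sectionsRing F) (F.obj j))
      naturality := fun _ _ f => Hom.ext <| funext fun s => (s.2 f).symm }

/-- The `C^∞`-ring of compatible families is the limit of the diagram. -/
def sectionsConeIsLimit : IsLimit (sectionsCone F) where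
  lift c := (⟨fun a => ⟨fun j => Hom.toFun (c.π.app j) a, fun _ _ f =>
      congrArg (fun φ => Hom.toFun φ a) (c.w f)⟩,
    fun f x => Subtype.ext <| funext fun j => Hom.map_op (c.π.app j) f x⟩ :
      Hom c.pt (sectionsRing F))
  fac _ _ := rfl
  uniq _ _ hm := Hom.ext <| funext fun a => Subtype.ext <| funext fun j =>
    congrArg (fun φ => Hom.toFun φ a) (hm j)

variable {F}

theorem exists_of_isLimit {c : Cone F} (hc : IsLimit c) (s : ∀ j, F.obj j)
    (hs : ∀ ⦃i j : J⦄ (f : i ⟶ j), Hom.toFun (F.map f) (s i) = s j) :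
    ∃ a : c.pt, ∀ j, Hom.toFun (c.π.app j) a = s j :=
  ⟨Hom.toFun (hc.lift (sectionsCone F)) (⟨s, hs⟩ : sectionsRing F), fun j =>
    congrArg (fun φ : sectionsRing F ⟶ F.obj j => Hom.toFun φ ⟨s, hs⟩)
      (hc.fac (sectionsCone F) j)⟩

/-- Any limit cone is isomorphic to the cone of compatible families, where equality is
componentwise. -/
theorem ext_of_isLimit {c : Cone F} (hc : IsLimit c) {a b : c.pt}
    (h : ∀ j, Hom.toFun (c.π.app j) a = Hom.toFun (c.π.app j) b) : a = b := by
  have key : (sectionsConeIsLimit F).lift c ≫ hc.lift (sectionsCone F) = 𝟙 c.pt :=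
    hc.hom_ext fun j => by simp
  have hab : Hom.toFun ((sectionsConeIsLimit F).lift c) a =
      Hom.toFun ((sectionsConeIsLimit F).lift c) b := Subtype.ext (funext h)
  calc a = Hom.toFun ((sectionsConeIsLimit F).lift c ≫ hc.lift (sectionsCone F)) a :=
        (congrArg (fun φ => Hom.toFun φ a) key).symm
    _ = Hom.toFun ((sectionsConeIsLimit F).lift c ≫ hc.lift (sectionsCone F)) b :=
        congrArg (Hom.toFun (hc.lift (sectionsCone F))) hab
    _ = b := congrArg (fun φ => Hom.toFun φ b) key

/-- The second equation, obtained by replacing `x` with `x² a`, is what makes the witness unique. -/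
theorem IsVonNeumannRegular.exists_quasiInverse {A : CInftyRingCat.{u}}
    (hA : IsVonNeumannRegular A) (a : A) : ∃ x : A, a = a ^ 2 * x ∧ x = x ^ 2 * a := by
  obtain ⟨x, hx⟩ := hA a
  refine ⟨x ^ 2 * a, ?_, ?_⟩
  · linear_combination (1 + a * x) * hx
  · linear_combination (x ^ 2 + x ^ 3 * a) * hx

theorem quasiInverse_unique {R : Type*} [CommRing R] {a x y : R} (hx : a = a ^ 2 * x)
    (hx' : x = x ^ 2 * a) (hy : a = a ^ 2 * y) (hy' : y = y ^ 2 * a) : x = y := by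
  have h₁ : x = x * a * y := by linear_combination hx' + x ^ 2 * hy - y * hx' * a
  have h₂ : y = x * a * y := by linear_combination hy' + y ^ 2 * hx - x * hy' * a
  exact h₁.trans h₂.symm

theorem isClosedUnderLimits_isVonNeumannRegular :
    IsClosedUnderLimits.{u} IsVonNeumannRegular := fun J _ => by
  refine ⟨?_⟩
  rintro X ⟨h⟩ a
  choose x hx hx' using fun j =>
    (h.prop_diag_obj j).exists_quasiInverse (Hom.toRingHom (h.π.app j) a)
  have hw {i j : _} (f : i ⟶ j) : Hom.toRingHom (h.diag.map f) (Hom.toRingHom (h.π.app i) a) =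
      Hom.toRingHom (h.π.app j) a :=
    congrArg (fun φ => Hom.toFun φ a) (h.cone.w f)
  obtain ⟨b, hb⟩ := exists_of_isLimit h.isLimit x fun i j f => by
    change Hom.toRingHom (h.diag.map f) (x i) = x j
    refine quasiInverse_unique (a := Hom.toRingHom (h.π.app j) a) ?_ ?_ (hx j) (hx' j)
    · rw [← hw f, ← map_pow, ← map_mul, ← hx i]
    · rw [← hw f, ← map_pow, ← map_mul, ← hx' i]
  refine ⟨b, ext_of_isLimit h.isLimit fun j => ?_⟩
  change Hom.toRingHom (h.π.app j) a = Hom.toRingHom (h.π.app j) (a ^ 2 * b)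
  rw [map_mul, map_pow]
  refine (hx j).trans (congrArg _ (hb j).symm)

theorem isVonNeumannRegular_of_isCInftyField :
    IsCInftyField.{u} ≤ IsVonNeumannRegular := by
  intro K hK a
  by_cases ha : a = 0
  · exact ⟨0, by simp [ha]⟩
  · obtain ⟨b, hb⟩ := hK.mul_inv_cancel ha
    exact ⟨b, by linear_combination (-a) * hb⟩

/-- The product of a family of `C^∞`-rings. -/
abbrev piRing {X : Type u} (K : X → CInftyRingCat.{u}) : CInftyRingCat.{u} :=
  sectionsRing (Discrete.functor K)

/-- The projections of a product of `C^∞`-rings. -/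
def piProj {X : Type u} (K : X → CInftyRingCat.{u}) (x : X) : piRing K ⟶ K x :=
  (sectionsCone (Discrete.functor K)).π.app ⟨x⟩

/-- The homomorphism to a product of `C^∞`-rings with given components. -/
def piLift {X : Type u} (K : X → CInftyRingCat.{u}) {A : CInftyRingCat.{u}}
    (φ : ∀ x, A ⟶ K x) : A ⟶ piRing K :=
  (sectionsConeIsLimit (Discrete.functor K)).lift (Fan.mk A φ)

theorem piRing_ext {X : Type u} {K : X → CInftyRingCat.{u}} {s t : piRing K}
    (h : ∀ x, Hom.toRingHom (piProj K x) s = Hom.toRingHom (piProj K x) t) : s = t :=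
  Subtype.ext (funext fun j => h j.as)

theorem piProj_piLift {X : Type u} {K : X → CInftyRingCat.{u}} {A : CInftyRingCat.{u}}
    (φ : ∀ x, A ⟶ K x) (x : X) (a : A) :
    Hom.toRingHom (piProj K x) (Hom.toRingHom (piLift K φ) a) = Hom.toRingHom (φ x) a :=
  rfl

theorem IsClosedUnderLimits.prop_piRing {P : ObjectProperty CInftyRingCat.{u}}
    (hP : IsClosedUnderLimits P) {X : Type u} {K : X → CInftyRingCat.{u}} (hK : ∀ x, P (K x)) :
    P (piRing K) := by
  have := hP (Discrete X)
  exact P.prop_of_isLimit (sectionsConeIsLimit (Discrete.functor K)) fun j => hK j.as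

/-- A property closed under limits is inherited by the equalizer of two homomorphisms. -/
theorem IsClosedUnderLimits.prop_of_equalizer {P : ObjectProperty CInftyRingCat.{u}}
    (hP : IsClosedUnderLimits P) {A B C : CInftyRingCat.{u}} (ι : A ⟶ B) (f g : B ⟶ C)
    (hB : P B) (hC : P C) (hι : Function.Injective (Hom.toRingHom ι))
    (hfg : ∀ b, (∃ a, Hom.toRingHom ι a = b) ↔ Hom.toRingHom f b = Hom.toRingHom g b) : P A := by
  -- Closure is assumed only for shapes in universe `u`, so the parallel pair is lifted there.
  have := hP (AsSmall.{u} WalkingParallelPair)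
  have : P.IsClosedUnderLimitsOfShape WalkingParallelPair :=
    .of_equivalence (AsSmall.equiv (C := WalkingParallelPair)).symm
  let c : Fork f g := Fork.ofι ι (Hom.ext <| funext fun a => (hfg _).1 ⟨a, rfl⟩)
  have hc : IsLimit c := Fork.IsLimit.mk' c fun s => by
    have h (z : s.pt) : ∃ a, Hom.toRingHom ι a = Hom.toRingHom s.ι z :=
      (hfg _).2 (congrArg (fun φ => Hom.toFun φ z) s.condition)
    choose k hk using h
    let φ : Hom s.pt A := ⟨k, fun {n} p x => hι <| by
      rw [hk]
      refine (Hom.map_op s.ι p x).trans (Eq.trans ?_ (Hom.map_op ι p _).symm)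
      exact congrArg _ (funext fun i => (hk (x i)).symm)⟩
    refine ⟨φ, Hom.ext (funext hk), fun {m} hm => Hom.ext (funext fun z => hι ?_)⟩
    exact (congrArg (fun φ => Hom.toFun φ z) hm).trans (hk z).symm
  exact P.prop_of_isLimit hc (by rintro (_ | _) <;> assumption)

end Limits

/-! ### Regular rings as equalizers of products of fields -/

section Representation

variable {A : CInftyRingCat.{u}}

theorem IsVonNeumannRegular.exists_notMem_mul_eq_zero (hA : IsVonNeumannRegular A) {p : Ideal A}
    [hp : p.IsPrime] {a : A} (ha : a ∈ p) : ∃ f ∉ p, f * a = 0 := by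
  obtain ⟨x, hx⟩ := hA a
  refine ⟨1 - a * x, fun h => hp.ne_top (p.eq_top_iff_one.2 ?_), by linear_combination hx⟩
  simpa using p.add_mem h (p.mul_mem_right x ha)

theorem IsVonNeumannRegular.isMaximal_of_isPrime (hA : IsVonNeumannRegular A) {p : Ideal A}
    [hp : p.IsPrime] : p.IsMaximal := by
  refine Ideal.isMaximal_iff.2 ⟨fun h => hp.ne_top (p.eq_top_iff_one.2 h), fun I a hpI ha haI => ?_⟩
  obtain ⟨x, hx⟩ := hA a
  have h : 1 - a * x ∈ p :=
    (hp.mem_or_mem (show a * (1 - a * x) ∈ p by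
      rw [show a * (1 - a * x) = 0 by linear_combination hx]; exact p.zero_mem)).resolve_left ha
  simpa using I.add_mem (hpI h) (I.mul_mem_right x haI)

/-- An element of a von Neumann regular extension `B` of `A` which lies in every maximal ideal of
`B` above a given maximal ideal of `A` is annihilated by an element of `A` outside that ideal. -/
theorem exists_notMem_map_mul_eq_zero {B : CInftyRingCat.{u}} (hA : IsVonNeumannRegular A)
    (hB : IsVonNeumannRegular B) (ι : A →+* B) (m : Ideal A) [hm : m.IsMaximal] (t : B)
    (ht : ∀ M : Ideal B, M.IsMaximal → M.comap ι = m → t ∈ M) : ∃ f ∉ m, ι f * t = 0 := by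
  -- `L` is the annihilator of `t` plus the kernel of the localization of `B` at the image of `A \
  -- m`. If proper, it lies in a maximal ideal, which is over `m` because that kernel contains the
  -- image of `m`.
  let L : Ideal B :=
    { carrier := {b | ∃ f ∉ m, ∃ c, c * t = 0 ∧ ι f * (b - c) = 0}
      zero_mem' := ⟨1, fun h => hm.ne_top (m.eq_top_iff_one.2 h), 0, by simp, by simp⟩
      add_mem' := by
        rintro b b' ⟨f, hf, c, hc, h⟩ ⟨f', hf', c', hc', h'⟩
        refine ⟨f * f', fun hff => (hm.isPrime.mem_or_mem hff).elim hf hf', c + c', ?_, ?_⟩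
        · linear_combination hc + hc'
        · rw [map_mul]
          linear_combination ι f' * h + ι f * h'
      smul_mem' := by
        rintro r b ⟨f, hf, c, hc, h⟩
        refine ⟨f, hf, r * c, by linear_combination r * hc, ?_⟩
        rw [smul_eq_mul]
        linear_combination r * h }
  by_cases hL : L = ⊤
  · obtain ⟨f, hf, c, hc, h⟩ := L.eq_top_iff_one.1 hL
    exact ⟨f, hf, by linear_combination t * h + ι f * hc⟩
  · obtain ⟨M, hM, hLM⟩ := L.exists_le_maximal hL
    have hmM : m ≤ M.comap ι := fun a ha => by
      obtain ⟨f, hf, hfa⟩ := hA.exists_notMem_mul_eq_zero ha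
      exact hLM ⟨f, hf, 0, zero_mul _, by rw [sub_zero, ← map_mul, hfa, map_zero]⟩
    have htM := ht M hM (hm.eq_of_le (hM.isPrime.comap ι).ne_top hmM).symm
    obtain ⟨y, hy⟩ := hB t
    -- This element annihilates `t`, so it is in `L`; but `t ∈ M` as well.
    have h1 : 1 - t * y ∈ M := hLM ⟨1, fun h => hm.ne_top (m.eq_top_iff_one.2 h), 1 - t * y,
      by linear_combination hy, by simp⟩
    refine absurd (M.eq_top_iff_one.2 ?_) hM.ne_top
    simpa using M.add_mem h1 (M.mul_mem_right y htM)

/-- Every von Neumann regular `C^∞`-ring is the equalizer of two homomorphisms between products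
of `C^∞`-fields. -/
theorem IsVonNeumannRegular.prop (hA : IsVonNeumannRegular A)
    {P : ObjectProperty CInftyRingCat.{u}} (hP : IsCInftyField ≤ P)
    (hP' : IsClosedUnderLimits P) : P A := by
  let K (m : MaximalSpectrum A) : CInftyRingCat.{u} := quotient A hA m.asIdeal
  have hK (m : MaximalSpectrum A) : IsCInftyField (K m) :=
    have := m.isMaximal
    isCInftyField_quotient hA m.asIdeal
  let B := piRing K
  have hB : IsVonNeumannRegular B := isClosedUnderLimits_isVonNeumannRegular.prop_piRing
    fun m => isVonNeumannRegular_of_isCInftyField _ (hK m)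
  let ι : A ⟶ B := piLift K fun m => quotientMk hA m.asIdeal
  let L (M : MaximalSpectrum B) : CInftyRingCat.{u} := quotient B hB M.asIdeal
  have hL (M : MaximalSpectrum B) : IsCInftyField (L M) :=
    have := M.isMaximal
    isCInftyField_quotient hB M.asIdeal
  let res (M : MaximalSpectrum B) : MaximalSpectrum A :=
    ⟨M.asIdeal.comap (Hom.toRingHom ι),
      have := M.isMaximal.isPrime.comap (Hom.toRingHom ι)
      hA.isMaximal_of_isPrime⟩
  have hres (M : MaximalSpectrum B) (a : A) (ha : a ∈ (res M).asIdeal) :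
      Hom.toRingHom (ι ≫ quotientMk hB M.asIdeal) a = 0 :=
    (quotientMk_eq_zero_iff hB M.asIdeal).2 ha
  let f : B ⟶ piRing L := piLift L fun M => quotientMk hB M.asIdeal
  let g : B ⟶ piRing L := piLift L fun M =>
    piProj K (res M) ≫ quotientLift hA (res M).asIdeal (ι ≫ quotientMk hB M.asIdeal) (hres M)
  have hg (M : MaximalSpectrum B) (s : B) (a : A)
      (ha : Hom.toRingHom (piProj K (res M)) s = Hom.toRingHom (quotientMk hA (res M).asIdeal) a) :
      Hom.toRingHom (piProj L M) (Hom.toRingHom g s) =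
        Hom.toRingHom (quotientMk hB M.asIdeal) (Hom.toRingHom ι a) := by
    rw [piProj_piLift]
    change Hom.toRingHom (quotientLift hA _ _ (hres M)) (Hom.toRingHom (piProj K (res M)) s) = _
    rw [ha, quotientLift_quotientMk]
    rfl
  refine hP'.prop_of_equalizer ι f g (hP'.prop_piRing fun m => hP _ (hK m))
    (hP'.prop_piRing fun M => hP _ (hL M)) ?_ fun s => ⟨?_, fun hs => ?_⟩
  · refine (injective_iff_map_eq_zero _).2 fun a ha => ?_
    obtain ⟨x, hx⟩ := hA a
    -- An element killed by `ι` is in every maximal ideal, so `1 - a * x` is in none; yet it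
    -- annihilates `a`.
    have hu : IsUnit (1 - a * x) := by
      by_contra hu
      obtain ⟨m, hm, ham⟩ := exists_max_ideal_of_mem_nonunits hu
      have ha' : a ∈ m := by
        rw [← quotientMk_eq_zero_iff hA m]
        exact (congrArg (Hom.toRingHom (piProj K ⟨m, hm⟩)) ha).trans (map_zero _)
      exact hm.ne_top (m.eq_top_iff_one.2 (by simpa using m.add_mem ham (m.mul_mem_right x ha')))
    exact hu.mul_right_eq_zero.1 (by linear_combination hx)
  · rintro ⟨a, rfl⟩
    refine piRing_ext fun M => ?_
    rw [hg M _ a (piProj_piLift _ _ _), piProj_piLift]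
  -- `I` is the ideal of denominators of `s`; showing that no maximal ideal contains it puts `s`
  -- itself in the image of `ι`.
  · let I : Ideal A :=
      { carrier := {a | ∃ b, Hom.toRingHom ι b = Hom.toRingHom ι a * s}
        zero_mem' := ⟨0, by simp⟩
        add_mem' := by
          rintro a a' ⟨b, hb⟩ ⟨b', hb'⟩
          exact ⟨b + b', by rw [map_add, map_add, hb, hb', add_mul]⟩
        smul_mem' := by
          rintro r a ⟨b, hb⟩
          exact ⟨r * b, by rw [smul_eq_mul, map_mul, map_mul, hb, mul_assoc]⟩ }
    have hI : I = ⊤ := by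
      by_contra hI
      obtain ⟨m, hm, hIm⟩ := I.exists_le_maximal hI
      obtain ⟨a, ha⟩ := quotientMk_surjective hA m (Hom.toRingHom (piProj K ⟨m, hm⟩) s)
      obtain ⟨d, hd, hds⟩ := exists_notMem_map_mul_eq_zero hA hB (Hom.toRingHom ι) m
        (s - Hom.toRingHom ι a) fun M hM hMm => by
          subst hMm
          rw [← quotientMk_eq_iff hB, ← hg ⟨M, hM⟩ s a ha.symm, ← hs]
          rfl
      refine hd (hIm ⟨d * a, ?_⟩)
      rw [map_mul]
      linear_combination -hds
    obtain ⟨b, hb⟩ := I.eq_top_iff_one.1 hI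
    exact ⟨b, by rw [hb, map_one, one_mul]⟩

end Representation

end CInftyRingCat

/-- Among the full subcategories of the category of `C^∞`-rings (that is, properties of objects)
that contain all `C^∞`-fields and are closed under limits, the von Neumann regular `C^∞`-rings form
the smallest one. -/
theorem proposition3 :
    IsLeast {P : ObjectProperty CInftyRingCat.{u} |
        CInftyRingCat.IsCInftyField ≤ P ∧ CInftyRingCat.IsClosedUnderLimits P}
      CInftyRingCat.IsVonNeumannRegular := by
  exact ⟨⟨CInftyRingCat.isVonNeumannRegular_of_isCInftyField,
    CInftyRingCat.isClosedUnderLimits_isVonNeumannRegular⟩,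
    fun _ hP _ hA => hA.prop hP.1 hP.2⟩
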